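/- For $q \ge 1$ let $Q_q$ be the $q$-dimensional hypercube: its vertices are the $q$-tuples in $\{0,1\}^q$, and two vertices are adjacent exactly when they differ in exactly one coordinate. Let $P_m$ be the path of length $m$, that is, the path with $m$ edges and $m+1$ vertices. A graph $H$ divides a graph $G$ if there is a collection $\{H_i\}$ of subgraphs of $G$, each isomorphic to $H$, such that $E(G)$ is the disjoint union of the sets $E(H_i)$. For every integer $t$ with $16 \le t \le 31$ and every integer $q \ge 2^t$ (odd or even), $P_{2^t}$ divides $Q_q$. -/

import Mathlib

/-- The `q`-dimensional hypercube `Q_q`: its vertices are the `q`-tuples over `ℤ/2`, and two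
vertices are adjacent when they differ in exactly one coordinate. -/
def hypercube (q : ℕ) : SimpleGraph (Fin q → ZMod 2) where
  Adj x y := ∃! i, x i ≠ y i
  symm := ⟨fun x y h => by simpa only [ne_comm] using h⟩
  loopless := ⟨fun x h => by simpa using h.exists⟩

/-- The path `P_m` of length `m`: it has `m` edges and vertex set `{0, 1, …, m}`, consecutive
vertices being adjacent. -/
abbrev pathOfLength (m : ℕ) : SimpleGraph (Fin (m + 1)) :=
  SimpleGraph.pathGraph (m + 1)

/-- `H` divides `G`: there is a collection of subgraphs of `G`, each isomorphic to `H`, such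
that the edge set of `G` is the disjoint union of their edge sets. -/
def GraphDivides {U V : Type*} (H : SimpleGraph U) (G : SimpleGraph V) : Prop :=
  ∃ C : Set G.Subgraph,
    (∀ K ∈ C, Nonempty (K.coe ≃g H)) ∧
    C.PairwiseDisjoint SimpleGraph.Subgraph.edgeSet ∧
    ⋃ K ∈ C, K.edgeSet = G.edgeSet

/-!
Write the cube `Q_q` as `A □ Q_n` with `A = Q_32`, and put `m = 2 ^ t`.

The edges of `A` split into sixteen Hamiltonian cycles of length `2 ^ 32`, each followed by a
permutation of the vertices (`exists_cycleFactorization_hypercube`). This comes from repeated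
doubling: the torus `C_N □ C_N` splits into two Hamiltonian cycles, one moving horizontally
except at the points whose coordinates add up to `-1`, the other making the opposite choices
(`CycleFactorization.boxProdSelf`).

Distinguish the copies of `A` in `A □ Q_n` over vertices of even and of odd weight of `Q_n`; each
Hamiltonian cycle then gives two half-families, and there are `32` of these. From every `(x, y)`
with `y` of even weight start a walk that flips the `n` coordinates of `y` in order and makes, after
each of the first `L` flips, one move along the next of `L` half-families. Flips separate these
moves, so the walk is a path, of length `n + L`. As the starting points all have even weight, the
edges of these paths are, once each, all edges in the directions of `Q_n` and all edges of the `L`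
half-families (`pathPartition_interleavedWalk`). The other half-families consist of cycles of
length `2 ^ 32`, which can be cut into paths of length `m` (`PathPartition.of_perm`).

The choice `L = m - n` requires `0 ≤ m - n ≤ 32`, that is `m ≤ q ≤ m + 32`. For larger `q`, copies
of `Q_32` are split off; their Hamiltonian cycles are cut into paths of length `m`.
-/

/-! ### Partitions of edge sets into paths -/

/-- A partition of the edge set `E` into paths of length `m`: a family of vertex sequences whose
terms `0, …, m` are distinct, such that every element of `E` is a step of exactly one of them.
Terms beyond the `m`-th are irrelevant. -/
def PathPartition {V : Type} (m : ℕ) (E : Set (Sym2 V)) : Prop :=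
  ∃ (I : Type) (w : I → ℕ → V),
    (∀ i, Set.InjOn (w i) (Set.Iic m)) ∧
    (∀ i, ∀ k < m, s(w i k, w i (k + 1)) ∈ E) ∧
    (∀ e ∈ E, ∃ i, ∃ k < m, s(w i k, w i (k + 1)) = e) ∧
    ∀ i j, ∀ k < m, ∀ l < m, s(w i k, w i (k + 1)) = s(w j l, w j (l + 1)) → i = j ∧ k = l

namespace PathPartition

variable {V W : Type} {m : ℕ}

theorem iUnion {ι : Type} {E : ι → Set (Sym2 V)} (h : ∀ i, PathPartition m (E i))
    (hE : ∀ i j e, e ∈ E i → e ∈ E j → i = j) : PathPartition m (⋃ i, E i) := by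
  choose I w hinj hmem hcov huniq using h
  refine ⟨Σ i, I i, fun p => w p.1 p.2, fun p => hinj _ _,
    fun p k hk => Set.mem_iUnion.2 ⟨p.1, hmem _ _ k hk⟩, fun e he => ?_, ?_⟩
  · obtain ⟨i, hi⟩ := Set.mem_iUnion.1 he
    obtain ⟨a, ha⟩ := hcov i e hi
    exact ⟨⟨i, a⟩, ha⟩
  · rintro ⟨i, a⟩ ⟨j, b⟩ k hk l hl h
    obtain rfl : i = j := hE i j _ (hmem i a k hk) (h ▸ hmem j b l hl)
    obtain ⟨rfl, rfl⟩ := huniq i a b k hk l hl h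
    exact ⟨rfl, rfl⟩

theorem union {E F : Set (Sym2 V)} (hE : PathPartition m E) (hF : PathPartition m F)
    (h : ∀ e ∈ E, e ∉ F) : PathPartition m (E ∪ F) := by
  rw [Set.union_eq_iUnion]
  refine iUnion (by rintro (_ | _) <;> assumption) ?_
  rintro (_ | _) (_ | _) e h₁ h₂
  · rfl
  · exact absurd h₁ (h e h₂)
  · exact absurd h₂ (h e h₁)
  · rfl

theorem image {E : Set (Sym2 V)} (h : PathPartition m E) {φ : V → W}
    (hφ : Function.Injective φ) : PathPartition m (Sym2.map φ '' E) := by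
  obtain ⟨I, w, hinj, hmem, hcov, huniq⟩ := h
  refine ⟨I, fun i k => φ (w i k), fun i => hφ.comp_injOn (hinj i),
    fun i k hk => ⟨_, hmem i k hk, rfl⟩, ?_, fun i j k hk l hl h => ?_⟩
  · rintro _ ⟨e, he, rfl⟩
    obtain ⟨i, k, hk, rfl⟩ := hcov e he
    exact ⟨i, k, hk, rfl⟩
  · exact huniq i j k hk l hl (Sym2.map.injective hφ h)

theorem of_iso {G : SimpleGraph V} {H : SimpleGraph W} (φ : G ≃g H)
    (h : PathPartition m G.edgeSet) : PathPartition m H.edgeSet := by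
  convert h.image φ.injective
  ext e
  induction e with | h x y => ?_
  constructor
  · intro he
    refine ⟨s(φ.symm x, φ.symm y), ?_, by simp⟩
    exact (φ.symm.map_adj_iff).2 he
  · rintro ⟨e, he, hxy⟩
    induction e with | h u v => ?_
    rw [← hxy]
    exact φ.map_adj_iff.2 he

theorem boxProd {G : SimpleGraph V} {H : SimpleGraph W} (hG : PathPartition m G.edgeSet)
    (hH : PathPartition m H.edgeSet) : PathPartition m (G □ H).edgeSet := by
  have key : (G □ H).edgeSet = (⋃ b, Sym2.map (fun a => (a, b)) '' G.edgeSet) ∪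
      ⋃ a, Sym2.map (fun b => (a, b)) '' H.edgeSet := by
    ext e
    induction e with | h p q => ?_
    obtain ⟨a, b⟩ := p
    obtain ⟨c, d⟩ := q
    simp only [SimpleGraph.mem_edgeSet, SimpleGraph.boxProd_adj, Set.mem_union, Set.mem_iUnion,
      Set.mem_image]
    constructor
    · rintro (⟨h, rfl⟩ | ⟨h, rfl⟩)
      · exact .inl ⟨b, s(a, c), h, rfl⟩
      · exact .inr ⟨a, s(b, d), h, rfl⟩
    · rintro (⟨y, e, he, hy⟩ | ⟨x, e, he, hx⟩)
      · induction e with | h u v => ?_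
        simp only [Sym2.map_mk, Sym2.eq_iff, Prod.mk.injEq] at hy
        rcases hy with ⟨⟨rfl, rfl⟩, rfl, rfl⟩ | ⟨⟨rfl, rfl⟩, rfl, rfl⟩
        · exact .inl ⟨he, rfl⟩
        · exact .inl ⟨SimpleGraph.Adj.symm he, rfl⟩
      · induction e with | h u v => ?_
        simp only [Sym2.map_mk, Sym2.eq_iff, Prod.mk.injEq] at hx
        rcases hx with ⟨⟨rfl, rfl⟩, rfl, rfl⟩ | ⟨⟨rfl, rfl⟩, rfl, rfl⟩
        · exact .inr ⟨he, rfl⟩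
        · exact .inr ⟨SimpleGraph.Adj.symm he, rfl⟩
  rw [key]
  refine union (iUnion (fun b => hG.image fun x y h => (Prod.mk.inj h).1) ?_)
    (iUnion (fun a => hH.image fun x y h => (Prod.mk.inj h).2) ?_) ?_
  · rintro b b' _ ⟨e, -, rfl⟩ ⟨e', -, h⟩
    induction e with | h u v => ?_
    induction e' with | h u' v' => ?_
    simp only [Sym2.map_mk, Sym2.eq_iff, Prod.mk.injEq] at h
    grind
  · rintro a a' _ ⟨e, -, rfl⟩ ⟨e', -, h⟩
    induction e with | h u v => ?_
    induction e' with | h u' v' => ?_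
    simp only [Sym2.map_mk, Sym2.eq_iff, Prod.mk.injEq] at h
    grind
  · intro e he he'
    simp only [Set.mem_iUnion, Set.mem_image] at he he'
    obtain ⟨b, e, he, rfl⟩ := he
    obtain ⟨a, e', -, h⟩ := he'
    induction e with | h u v => ?_
    induction e' with | h u' v' => ?_
    have := SimpleGraph.Adj.ne he
    simp only [Sym2.map_mk, Sym2.eq_iff, Prod.mk.injEq] at h
    grind

theorem graphDivides {G : SimpleGraph V} (h : PathPartition m G.edgeSet) :
    GraphDivides (pathOfLength m) G := by
  obtain ⟨I, w, hinj, hmem, hcov, huniq⟩ := h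
  let c : I → SimpleGraph.Copy (pathOfLength m) G := fun i =>
    ⟨⟨fun k => w i k, by
      intro a b hab
      rcases SimpleGraph.pathGraph_adj.1 hab with h | h
      · rw [← h]; exact hmem i a (by omega)
      · rw [← h]; exact (hmem i b (by omega) : G.Adj _ _).symm⟩,
      fun a b hab => Fin.ext (hinj i (Set.mem_Iic.2 (by omega)) (Set.mem_Iic.2 (by omega)) hab)⟩
  have hc : ∀ i e, e ∈ (c i).toSubgraph.edgeSet ↔ ∃ k < m, s(w i k, w i (k + 1)) = e := by
    intro i e
    induction e with | h x y => ?_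
    rw [SimpleGraph.Subgraph.mem_edgeSet]
    constructor
    · intro h
      obtain ⟨a, b, hab, rfl, rfl⟩ := SimpleGraph.Subgraph.map_adj .. ▸ h
      rcases SimpleGraph.pathGraph_adj.1 hab with h | h
      · exact ⟨a, by omega, by rw [h]; rfl⟩
      · exact ⟨b, by omega, by rw [h]; exact Sym2.eq_swap⟩
    · rintro ⟨k, hk, h⟩
      rw [← SimpleGraph.Subgraph.mem_edgeSet, ← h, SimpleGraph.Subgraph.mem_edgeSet]
      exact ⟨⟨k, by omega⟩, ⟨k + 1, by omega⟩, SimpleGraph.pathGraph_adj.2 (.inl rfl), rfl, rfl⟩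
  refine ⟨Set.range fun i => (c i).toSubgraph, ?_, ?_, ?_⟩
  · rintro _ ⟨i, rfl⟩
    exact ⟨(c i).isoToSubgraph.symm⟩
  · rintro _ ⟨i, rfl⟩ _ ⟨j, rfl⟩ hij
    refine Set.disjoint_left.2 fun e hi hj => hij ?_
    obtain ⟨k, hk, rfl⟩ := (hc i e).1 hi
    obtain ⟨l, hl, h⟩ := (hc j _).1 hj
    rw [(huniq i j k hk l hl h.symm).1]
  · ext e
    simp only [Set.mem_range, Set.iUnion_exists, Set.iUnion_iUnion_eq', Set.mem_iUnion, hc]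
    constructor
    · rintro ⟨i, k, hk, rfl⟩
      exact hmem i k hk
    · exact hcov e

/-- Paths cut from long cycles. The clock `c` advances by one at each application of `f`, so
all cycles of `f` have a length divisible by `N`, and cutting them wherever the clock shows a
multiple of `m` yields paths of length `m`. -/
theorem of_perm {N : ℕ} (hm : 0 < m) (hmN : m ∣ N) (hlt : m < N) (hN : 2 < N)
    {f : Equiv.Perm V} {c : V → ZMod N} (hc : ∀ x, c (f x) = c x + 1) :
    PathPartition m (Set.range fun x => s(x, f x)) := by
  have : NeZero N := ⟨by omega⟩
  have hpow : ∀ (k : ℕ) x, c ((f ^ k) x) = c x + k := by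
    intro k
    induction k with
    | zero => simp
    | succ k ih => intro x; rw [pow_succ', Equiv.Perm.mul_apply, hc, ih]; push_cast; ring
  have hinj : ∀ x y, s(x, f x) = s(y, f y) → x = y := by
    intro x y h
    rcases Sym2.eq_iff.1 h with ⟨h, -⟩ | ⟨h₁, h₂⟩
    · exact h
    · -- otherwise `x` lies on a cycle of length two
      have h₃ : c x = c x + (2 : ℕ) := by
        conv_lhs => rw [h₁, ← h₂, hc, hc]
        push_cast; ring
      have := (ZMod.natCast_eq_zero_iff 2 N).1 (by simpa using h₃)
      exact absurd (Nat.le_of_dvd (by omega) this) (by omega)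
  -- a path starting where the clock shows a multiple of `m` does not pass the end of the clock
  have hval : ∀ x, m ∣ (c x).val → ∀ k < m, (c ((f ^ k) x)).val = (c x).val + k := by
    intro x hx k hk
    have h₁ := ZMod.val_lt (c x)
    obtain ⟨a, ha⟩ := hx
    obtain ⟨b, rfl⟩ := hmN
    have h₂ : a + 1 ≤ b := by
      rw [ha] at h₁
      exact Nat.lt_of_mul_lt_mul_left h₁
    have h₃ := Nat.mul_le_mul_left m h₂
    have hlt' : (c x).val + k < m * b := by rw [ha]; linarith
    rw [hpow, ← ZMod.val_cast_of_lt hlt']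
    push_cast
    rw [ZMod.natCast_zmod_val]
  refine ⟨{x // m ∣ (c x).val}, fun x k => (f ^ k) x.1, ?_, ?_, ?_, ?_⟩
  · intro x k hk l hl h
    rw [Set.mem_Iic] at hk hl
    have h' := congrArg c h
    simp only [hpow, add_right_inj] at h'
    have := congrArg ZMod.val h'
    rwa [ZMod.val_cast_of_lt (by omega), ZMod.val_cast_of_lt (by omega)] at this
  · intro x k _
    exact ⟨(f ^ k) x.1, by simp only [pow_succ', Equiv.Perm.mul_apply]⟩
  · rintro _ ⟨z, rfl⟩
    set k := (c z).val % m with hk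
    have hz : (f ^ k) ((f ^ k)⁻¹ z) = z := (f ^ k).apply_symm_apply z
    refine ⟨⟨(f ^ k)⁻¹ z, ?_⟩, k, Nat.mod_lt _ hm, ?_⟩
    · have h₁ := hpow k ((f ^ k)⁻¹ z)
      rw [hz] at h₁
      have h₂ : c ((f ^ k)⁻¹ z) = ((m * ((c z).val / m) : ℕ) : ZMod N) := by
        rw [← add_left_inj (k : ZMod N), ← h₁, ← Nat.cast_add, hk, Nat.div_add_mod,
          ZMod.natCast_zmod_val]
      rw [h₂, ZMod.val_cast_of_lt]
      · exact Dvd.intro _ rfl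
      · exact (Nat.mul_div_le _ _).trans_lt (ZMod.val_lt _)
    · simp only [pow_succ', Equiv.Perm.mul_apply, hz]
  · rintro ⟨x, hx⟩ ⟨y, hy⟩ k hk l hl h
    simp only [pow_succ', Equiv.Perm.mul_apply] at h
    have h' := hinj _ _ h
    have h₁ := congrArg (fun z => (c z).val) h'
    simp only [hval x hx k hk, hval y hy l hl] at h₁
    obtain rfl : k = l := by
      have h₂ := congrArg (· % m) h₁
      obtain ⟨a, ha⟩ := hx
      obtain ⟨b, hb⟩ := hy
      simpa [ha, hb, Nat.mul_add_mod, Nat.mod_eq_of_lt, hk, hl] using h₂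
    exact ⟨Subtype.ext ((f ^ k).injective h'), rfl⟩

end PathPartition

/-! ### Cycle factorizations -/

/-- A decomposition of `G` into spanning families of long oriented cycles. The permutation
`next i` follows the cycles of the `i`-th family, every edge of `G` is `s(x, next i x)` for
exactly one pair `(i, x)`, and the clock `pos i` advances by one along each cycle, which forces
all cycle lengths to be multiples of `N`. -/
structure CycleFactorization {V : Type} (G : SimpleGraph V) (ι : Type) (N : ℕ) where
  next : ι → Equiv.Perm V
  pos : ι → V → ZMod N
  pos_next : ∀ i x, pos i (next i x) = pos i x + 1
  adj_next : ∀ i x, G.Adj x (next i x)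
  exists_next : ∀ u v, G.Adj u v → ∃ i x, s(x, next i x) = s(u, v)
  next_unique : ∀ i j x y, s(x, next i x) = s(y, next j y) → i = j ∧ x = y

/-- The clock of the Hamiltonian cycle of the torus `C_N □ C_N` that increases `b` where
`a + b = -1` and increases `a` elsewhere: it counts in base `N`, with digits `b` and `a + b`. -/
def torusClock {N : ℕ} (a b : ZMod N) : ZMod (N * N) :=
  ((N * b.val + (a + b).val : ℕ) : ZMod (N * N))

theorem torusClock_turn {N : ℕ} (hN : 2 ≤ N) {a b : ZMod N} (h : a + b = -1) :
    torusClock a (b + 1) = torusClock a b + 1 := by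
  have : NeZero N := ⟨by omega⟩
  have h₁ : a + (b + 1) = 0 := by rw [← add_assoc, h]; ring
  have h₂ : (-1 : ZMod N).val + 1 = N := by
    obtain ⟨n, rfl⟩ : ∃ n, N = n + 1 := ⟨N - 1, by omega⟩
    rw [ZMod.val_neg_one]
  have h₃ : (b + 1).val ≡ b.val + 1 [MOD N] := by
    rw [← ZMod.natCast_eq_natCast_iff]; simp
  unfold torusClock
  rw [h₁, h, ZMod.val_zero, add_zero, ← Nat.cast_add_one, add_assoc, h₂,
    ZMod.natCast_eq_natCast_iff, ← Nat.mul_add_one]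
  exact h₃.mul_left' N

theorem torusClock_straight {N : ℕ} (hN : 2 ≤ N) {a b : ZMod N} (h : a + b ≠ -1) :
    torusClock (a + 1) b = torusClock a b + 1 := by
  have : NeZero N := ⟨by omega⟩
  have : Fact (1 < N) := ⟨by omega⟩
  have h₁ : (a + 1 + b).val = (a + b).val + 1 := by
    have hlt := ZMod.val_lt (a + b)
    rw [add_right_comm, ZMod.val_add_of_lt, ZMod.val_one]
    rw [ZMod.val_one]
    by_contra hge
    have h' : (a + b).val = N - 1 := by omega
    apply h
    rw [← ZMod.natCast_zmod_val (a + b), h', Nat.cast_sub (by omega)]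
    simp
  unfold torusClock
  rw [h₁]
  push_cast; ring

/-- One of the two families of cycles into which the product of a cycle family with itself
splits: `torusStep c f hc false` moves the first coordinate, except where the clocks add up
to `-1`, and `torusStep c f hc true` makes the opposite choice everywhere. -/
def torusStep {V : Type} {N : ℕ} (c : V → ZMod N) (f : Equiv.Perm V)
    (hc : ∀ x, c (f x) = c x + 1) (b : Bool) : Equiv.Perm (V × V) where
  toFun p := if decide (c p.1 + c p.2 = -1) = b then (f p.1, p.2) else (p.1, f p.2)
  invFun p := if decide (c p.1 + c p.2 = 0) = b then (f.symm p.1, p.2) else (p.1, f.symm p.2)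
  left_inv p := by
    have h : ∀ s : ZMod N, s + 1 = 0 ↔ s = -1 := fun s => eq_neg_iff_add_eq_zero.symm
    have h₁ : c (f p.1) + c p.2 = c p.1 + c p.2 + 1 := by rw [hc]; ring
    have h₂ : c p.1 + c (f p.2) = c p.1 + c p.2 + 1 := by rw [hc]; ring
    by_cases hp : decide (c p.1 + c p.2 = -1) = b
    · simp only [if_pos hp, h₁, h, Equiv.symm_apply_apply]
    · simp only [if_neg hp, h₂, h, Equiv.symm_apply_apply]
  right_inv p := by
    have h : ∀ s : ZMod N, s - 1 = -1 ↔ s = 0 := fun s => by rw [sub_eq_neg_self]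
    have hs : ∀ x, c (f.symm x) = c x - 1 := fun x => by
      rw [eq_sub_iff_add_eq, ← hc, Equiv.apply_symm_apply]
    have h₁ : c (f.symm p.1) + c p.2 = c p.1 + c p.2 - 1 := by rw [hs]; ring
    have h₂ : c p.1 + c (f.symm p.2) = c p.1 + c p.2 - 1 := by rw [hs]; ring
    by_cases hp : decide (c p.1 + c p.2 = 0) = b
    · simp only [if_pos hp, h₁, h, Equiv.apply_symm_apply]
    · simp only [if_neg hp, h₂, h, Equiv.apply_symm_apply]

namespace CycleFactorization

variable {V W : Type} {G : SimpleGraph V} {H : SimpleGraph W} {ι κ : Type} {N : ℕ}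

/-- Relabels the cycle families. -/
def reindex (F : CycleFactorization G ι N) (e : κ ≃ ι) : CycleFactorization G κ N where
  next i := F.next (e i)
  pos i := F.pos (e i)
  pos_next _ := F.pos_next _
  adj_next _ := F.adj_next _
  exists_next u v h := by
    obtain ⟨i, x, hx⟩ := F.exists_next u v h
    exact ⟨e.symm i, x, by simpa using hx⟩
  next_unique i j x y h := by
    obtain ⟨h₁, h₂⟩ := F.next_unique _ _ x y h
    exact ⟨e.injective h₁, h₂⟩

/-- Transports a cycle factorization along a graph isomorphism. -/
def mapIso (F : CycleFactorization G ι N) (φ : G ≃g H) : CycleFactorization H ι N where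
  next i := (φ.toEquiv.symm.trans (F.next i)).trans φ.toEquiv
  pos i x := F.pos i (φ.symm x)
  pos_next i x := by
    have : φ.symm (φ (F.next i (φ.symm x))) = F.next i (φ.symm x) := φ.symm_apply_apply _
    exact (congrArg (F.pos i) this).trans (F.pos_next i _)
  adj_next i x := by
    have := φ.map_adj_iff.2 (F.adj_next i (φ.symm x))
    rwa [φ.apply_symm_apply] at this
  exists_next u v h := by
    obtain ⟨i, x, hx⟩ := F.exists_next _ _ (φ.symm.map_adj_iff.2 h)
    refine ⟨i, φ x, ?_⟩
    have := congrArg (Sym2.map φ) hx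
    simp only [Sym2.map_mk, φ.apply_symm_apply] at this
    rw [← this]
    exact congrArg (fun z => s(φ x, φ (F.next i z))) (φ.symm_apply_apply x)
  next_unique i j x y h := by
    have := congrArg (Sym2.map φ.symm) h
    have hs : ∀ i x, φ.symm (φ (F.next i (φ.symm x))) = F.next i (φ.symm x) :=
      fun i x => φ.symm_apply_apply _
    obtain ⟨h₁, h₂⟩ := F.next_unique i j (φ.symm x) (φ.symm y) (by
      rw [← hs i x, ← hs j y]; exact this)
    exact ⟨h₁, φ.symm.injective h₂⟩

/-- The product of an `N`-cycle with itself is the union of two cycles of length `N * N`, and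
`G □ G` is the edge-disjoint union of the products of each cycle family of `G` with itself. -/
def boxProdSelf (F : CycleFactorization G ι N) (hN : 2 ≤ N) :
    CycleFactorization (G □ G) (ι × Bool) (N * N) where
  next i := torusStep (F.pos i.1) (F.next i.1) (F.pos_next i.1) i.2
  pos i p := if i.2 then torusClock (F.pos i.1 p.2) (F.pos i.1 p.1)
    else torusClock (F.pos i.1 p.1) (F.pos i.1 p.2)
  pos_next := by
    rintro ⟨i, b⟩ ⟨x, y⟩
    have hc := F.pos_next i
    by_cases h : F.pos i x + F.pos i y = -1
    · have h' : F.pos i y + F.pos i x = -1 := by rwa [add_comm]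
      cases b <;> simp [torusStep, h, hc, torusClock_turn hN, h']
    · have h' : F.pos i y + F.pos i x ≠ -1 := by rwa [add_comm]
      cases b <;> simp [torusStep, h, hc, torusClock_straight hN, h']
  adj_next := by
    rintro ⟨i, b⟩ ⟨x, y⟩
    simp only [torusStep, Equiv.coe_fn_mk, SimpleGraph.boxProd_adj]
    split_ifs
    · exact .inl ⟨F.adj_next i x, rfl⟩
    · exact .inr ⟨F.adj_next i y, rfl⟩
  exists_next := by
    rintro ⟨u, v⟩ ⟨u', v'⟩ h
    rcases SimpleGraph.boxProd_adj.1 h with ⟨h, rfl : v = v'⟩ | ⟨h, rfl : u = u'⟩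
    · obtain ⟨i, x, hx⟩ := F.exists_next u u' h
      refine ⟨(i, decide (F.pos i x + F.pos i v = -1)), (x, v), ?_⟩
      simpa [torusStep] using congrArg (Sym2.map fun a => (a, v)) hx
    · obtain ⟨i, x, hx⟩ := F.exists_next v v' h
      refine ⟨(i, !decide (F.pos i u + F.pos i x = -1)), (u, x), ?_⟩
      simpa [torusStep] using congrArg (Sym2.map fun a => (u, a)) hx
  next_unique := by
    rintro ⟨i, b⟩ ⟨j, b'⟩ ⟨x, y⟩ ⟨x', y'⟩ h
    have hne := fun i x => (F.adj_next i x).ne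
    simp only [torusStep, Equiv.coe_fn_mk] at h
    have h₁ := congrArg (Sym2.map Prod.fst) h
    have h₂ := congrArg (Sym2.map Prod.snd) h
    split_ifs at h h₁ h₂ with hb hb' hb'
    · obtain ⟨rfl, rfl⟩ := F.next_unique i j x x' h₁
      obtain rfl : y = y' := by simpa using h₂
      exact ⟨Prod.ext rfl (hb.symm.trans hb'), rfl⟩
    · simp only [Sym2.map_mk, Sym2.eq_iff] at h₁
      grind
    · simp only [Sym2.map_mk, Sym2.eq_iff] at h₁
      grind
    · obtain ⟨rfl, rfl⟩ := F.next_unique i j y y' h₂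
      obtain rfl : x = x' := by simpa using h₁
      refine ⟨Prod.ext rfl ?_, rfl⟩
      cases b <;> cases b' <;> simp_all

end CycleFactorization

/-! ### Hypercubes -/

theorem hypercube_adj_iff {n : ℕ} {x y : Fin n → ZMod 2} :
    (hypercube n).Adj x y ↔ ∃ i, y = x + Pi.single i 1 := by
  have h2 : ∀ a b : ZMod 2, a ≠ b ↔ b = a + 1 := by decide
  constructor
  · rintro ⟨i, hi, hu⟩
    refine ⟨i, funext fun j => ?_⟩
    by_cases hj : j = i
    · subst hj
      simpa using (h2 _ _).1 hi
    · have : x j = y j := by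
        by_contra h
        exact hj (hu j h)
      simp [hj, this]
  · rintro ⟨i, rfl⟩
    refine ⟨i, by simp, fun j hj => ?_⟩
    by_contra h
    exact hj (by simp [h])

/-- Splits off the last `b` coordinates of a cube. -/
def hypercubeAddIso (a b : ℕ) : hypercube (a + b) ≃g hypercube a □ hypercube b where
  toEquiv := (Fin.appendEquiv a b).symm
  map_rel_iff' := by
    intro x y
    obtain ⟨⟨x₁, x₂⟩, rfl⟩ := (Fin.appendEquiv a b).surjective x
    obtain ⟨⟨y₁, y₂⟩, rfl⟩ := (Fin.appendEquiv a b).surjective y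
    have h₁ : ∀ i, Fin.append x₁ x₂ + Pi.single (Fin.castAdd b i) 1 =
        Fin.append (x₁ + Pi.single i 1) x₂ := fun i => by
      ext j
      refine Fin.addCases (fun k => ?_) (fun k => ?_) j <;> simp [Pi.single_apply]
      intro h; simp [Fin.ext_iff] at h; omega
    have h₂ : ∀ i, Fin.append x₁ x₂ + Pi.single (Fin.natAdd a i) 1 =
        Fin.append x₁ (x₂ + Pi.single i 1) := fun i => by
      ext j
      refine Fin.addCases (fun k => ?_) (fun k => ?_) j <;> simp [Pi.single_apply]
      intro h; simp [Fin.ext_iff] at h; omega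
    have hinj := fun p q : (Fin a → ZMod 2) × (Fin b → ZMod 2) =>
      (Fin.appendEquiv a b).injective.eq_iff (a := p) (b := q)
    simp only [Fin.appendEquiv, Equiv.coe_fn_mk, Prod.forall, Prod.mk.injEq] at hinj
    simp only [Equiv.symm_apply_apply, SimpleGraph.boxProd_adj, hypercube_adj_iff]
    simp only [Fin.appendEquiv, Equiv.coe_fn_mk]
    constructor
    · rintro (⟨⟨i, h⟩, h'⟩ | ⟨⟨i, h⟩, h'⟩)
      · exact ⟨Fin.castAdd b i, by rw [h₁, h, h']⟩
      · exact ⟨Fin.natAdd a i, by rw [h₂, h, h']⟩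
    · rintro ⟨j, h⟩
      induction j using Fin.addCases with
      | left i =>
        rw [h₁, hinj] at h
        exact .inl ⟨⟨i, h.1⟩, h.2.symm⟩
      | right i =>
        rw [h₂, hinj] at h
        exact .inr ⟨⟨i, h.2⟩, h.1.symm⟩

/-- The rotation of the square `hypercube 2`. -/
def hypercubeTwoCycle : Equiv.Perm (Fin 2 → ZMod 2) where
  toFun x := ![x 1 + 1, x 0]
  invFun x := ![x 1, x 0 + 1]
  left_inv := by decide
  right_inv := by decide

/-- The square is a single cycle of length four. -/
def hypercubeTwoFactorization : CycleFactorization (hypercube 2) Unit 4 where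
  next _ := hypercubeTwoCycle
  pos _ x := if x = 0 then 0 else if x = ![1, 0] then 1 else if x = ![1, 1] then 2 else 3
  pos_next := by decide
  adj_next := by simp only [hypercube_adj_iff]; decide
  exists_next := by simp only [hypercube_adj_iff]; decide
  next_unique := by decide

/-- The cube of dimension `2 ^ (k + 1)` decomposes into `2 ^ k` Hamiltonian cycles. -/
theorem exists_cycleFactorization_hypercube (k : ℕ) : Nonempty (CycleFactorization
    (hypercube (2 ^ (k + 1))) (Fin (2 ^ k)) (2 ^ 2 ^ (k + 1))) := by
  induction k with
  | zero => exact ⟨hypercubeTwoFactorization.reindex finOneEquiv⟩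
  | succ k ih =>
    obtain ⟨F⟩ := ih
    have e : Fin (2 ^ (k + 1)) ≃ Fin (2 ^ k) × Bool :=
      Fintype.equivOfCardEq (by simp [pow_succ])
    have h := (F.boxProdSelf (Nat.le_self_pow (by positivity) 2)).reindex e
    have h' := h.mapIso (hypercubeAddIso _ _).symm
    rw [← pow_add, ← mul_two, ← pow_succ] at h'
    exact ⟨h'⟩

/-! ### Interleaved walks -/

/-- The indicator vector of the first `j` coordinates. -/
def initialOnes (n j : ℕ) : Fin n → ZMod 2 := fun i => if i.val < j then 1 else 0

theorem initialOnes_zero (n : ℕ) : initialOnes n 0 = 0 := by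
  ext i; simp [initialOnes]

theorem initialOnes_succ {n : ℕ} (i : Fin n) :
    initialOnes n (i + 1) = initialOnes n i + Pi.single i 1 := by
  ext j
  simp only [initialOnes, Pi.add_apply, Pi.single_apply, Fin.ext_iff]
  grind

theorem sum_initialOnes {n j : ℕ} (h : j ≤ n) : ∑ i, initialOnes n j i = j := by
  induction j with
  | zero => simp [initialOnes_zero]
  | succ j ih =>
    rw [initialOnes_succ (⟨j, h⟩ : Fin n)]
    simp [Finset.sum_add_distrib, ih (by omega)]

theorem initialOnes_injOn (n : ℕ) : Set.InjOn (initialOnes n) (Set.Iic n) := by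
  have key : ∀ j k, j < k → k ≤ n → initialOnes n j ≠ initialOnes n k := by
    intro j k hjk hk h
    simpa [initialOnes, hjk] using congrFun h ⟨j, by omega⟩
  intro j hj k hk h
  rw [Set.mem_Iic] at hj hk
  rcases lt_trichotomy j k with hlt | rfl | hlt
  · exact absurd h (key j k hlt hk)
  · rfl
  · exact absurd h.symm (key k j hlt hj)

/-- The composite `g (k - 1) ∘ ⋯ ∘ g 0`. -/
def iterComp {V : Type} (g : ℕ → Equiv.Perm V) : ℕ → Equiv.Perm V
  | 0 => 1
  | k + 1 => g k * iterComp g k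

/-- The walk from `(x, y)` that flips the coordinates of `y` in order and, after each of the
first `L` flips, moves the other component by the next permutation of the sequence `g`. -/
def interleavedWalk {V : Type} {n : ℕ} (g : ℕ → Equiv.Perm V) (L : ℕ) (x : V)
    (y : Fin n → ZMod 2) (k : ℕ) : V × (Fin n → ZMod 2) :=
  (iterComp g (min (k / 2) L) x, y + initialOnes n (k - min (k / 2) L))

section InterleavedWalk

variable {V : Type} {n L : ℕ} {g : ℕ → Equiv.Perm V}

theorem interleavedWalk_succ_odd {j : ℕ} (hj : j < L) (x : V) (y : Fin n → ZMod 2) :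
    interleavedWalk g L x y (2 * j + 1) = (iterComp g j x, y + initialOnes n (j + 1)) ∧
    interleavedWalk g L x y (2 * j + 1 + 1) =
      (g j (iterComp g j x), y + initialOnes n (j + 1)) := by
  have h₁ : min ((2 * j + 1) / 2) L = j := by omega
  have h₂ : min ((2 * j + 1 + 1) / 2) L = j + 1 := by omega
  have h₃ : 2 * j + 1 - j = j + 1 := by omega
  have h₄ : 2 * j + 1 + 1 - (j + 1) = j + 1 := by omega
  simp only [interleavedWalk, h₁, h₂, h₃, h₄, iterComp, Equiv.Perm.mul_apply, and_self]

/-- The time at which the walk flips the coordinate `i`. -/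
def flipTime (L i : ℕ) : ℕ := i + min i L

theorem interleavedWalk_flipTime (i : Fin n) (x : V) (y : Fin n → ZMod 2) :
    interleavedWalk g L x y (flipTime L i) = (iterComp g (min i.val L) x, y + initialOnes n i) ∧
    interleavedWalk g L x y (flipTime L i + 1) =
      (iterComp g (min i.val L) x, y + initialOnes n i + Pi.single i 1) := by
  have h₁ : min (flipTime L i / 2) L = min i.val L := by unfold flipTime; omega
  have h₂ : min ((flipTime L i + 1) / 2) L = min i.val L := by unfold flipTime; omega
  have h₃ : flipTime L i - min i.val L = i := by unfold flipTime; omega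
  have h₄ : flipTime L i + 1 - min i.val L = i + 1 := by unfold flipTime; omega
  simp only [interleavedWalk, h₁, h₂, h₃, h₄, initialOnes_succ, add_assoc, and_self]

theorem exists_eq_flipTime (hL : L ≤ n) {k : ℕ} (hk : k < n + L) :
    (∃ j < L, k = 2 * j + 1) ∨ ∃ i : Fin n, k = flipTime L i := by
  unfold flipTime
  by_cases h : k % 2 = 1 ∧ k < 2 * L
  · exact .inl ⟨k / 2, by omega, by omega⟩
  · refine .inr ⟨⟨k - min (k / 2) L, by omega⟩, ?_⟩
    simp only
    omega

/-- Two moves by elements of `g` are always separated by the flip of a coordinate, and no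
coordinate is flipped twice, so the walk never returns to a vertex. -/
theorem interleavedWalk_injOn (hL : L ≤ n) (hg : ∀ j < L, ∀ x, g j x ≠ x) (x : V)
    (y : Fin n → ZMod 2) : Set.InjOn (interleavedWalk g L x y) (Set.Iic (n + L)) := by
  have key : ∀ k l, k < l → l ≤ n + L →
      interleavedWalk g L x y k ≠ interleavedWalk g L x y l := by
    intro k l hkl hl h
    have h₁ : k - min (k / 2) L = l - min (l / 2) L :=
      initialOnes_injOn n (Set.mem_Iic.2 (by omega)) (Set.mem_Iic.2 (by omega))
        (add_left_cancel (Prod.mk.inj h).2)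
    obtain ⟨j, hj, rfl⟩ : ∃ j < L, k = 2 * j + 1 := ⟨k / 2, by omega, by omega⟩
    obtain rfl : l = 2 * j + 1 + 1 := by omega
    rw [(interleavedWalk_succ_odd hj x y).1, (interleavedWalk_succ_odd hj x y).2] at h
    exact hg j hj _ (Prod.mk.inj h).1.symm
  intro k hk l hl h
  rw [Set.mem_Iic] at hk hl
  rcases lt_trichotomy k l with hlt | rfl | hlt
  · exact absurd h (key k l hlt hl)
  · rfl
  · exact absurd h.symm (key l k hlt hk)

theorem single_one_injective :
    Function.Injective fun i : Fin n => (Pi.single i 1 : Fin n → ZMod 2) := by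
  intro i j h
  by_contra hij
  simpa [hij] using congrFun h i

theorem add_single_add_single (y : Fin n → ZMod 2) (i : Fin n) :
    y + Pi.single i 1 + Pi.single i 1 = y := by
  ext k
  simp [add_assoc, CharTwo.add_self_eq_zero]

/-- The edges of the walks started at all `(x, y)` with `y` of even weight: all edges in the
cube directions, and the edges of `g j` with `j < L` on the layers of weight congruent to
`j + 1`. The weight of a vertex tells how many flips precede it, up to parity, which makes the
walk through a given edge unique. -/
theorem pathPartition_interleavedWalk (hL : L ≤ n) (hg : ∀ j < L, ∀ x, g j x ≠ x)
    (huniq : ∀ i < L, ∀ j < L, (i : ZMod 2) = j → ∀ x y, s(x, g i x) = s(y, g j y) →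
      i = j ∧ x = y) :
    PathPartition (n + L) ({e | ∃ (x : V) (y : Fin n → ZMod 2) (i : Fin n),
        s((x, y), (x, y + Pi.single i 1)) = e} ∪
      {e | ∃ j < L, ∃ (x : V) (y : Fin n → ZMod 2), ∑ i, y i = (j : ZMod 2) + 1 ∧
        s((x, y), (g j x, y)) = e}) := by
  have hsum : ∀ y : Fin n → ZMod 2, ∑ i, y i = 0 → ∀ j ≤ n,
      ∑ i, (y + initialOnes n j) i = (j : ZMod 2) := fun y hy j hj => by
    simp [Finset.sum_add_distrib, hy, sum_initialOnes hj]
  refine ⟨V × {y : Fin n → ZMod 2 // ∑ i, y i = 0},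
    fun p => interleavedWalk g L p.1 p.2.1, fun p => interleavedWalk_injOn hL hg _ _, ?_, ?_, ?_⟩
  · rintro ⟨x, y, hy⟩ k hk
    rcases exists_eq_flipTime hL hk with ⟨j, hj, rfl⟩ | ⟨i, rfl⟩
    · simp only [interleavedWalk_succ_odd hj]
      exact .inr ⟨j, hj, _, _, by rw [hsum y hy _ (by omega)]; simp, rfl⟩
    · simp only [interleavedWalk_flipTime]
      exact .inl ⟨_, _, i, rfl⟩
  · rintro e (⟨x, y, i, rfl⟩ | ⟨j, hj, x, y, hy, rfl⟩)
    · -- of the two ends of the edge, the walk reaches first the one of weight congruent to `i`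
      wlog hy : ∑ i, y i = ((i : ℕ) : ZMod 2) generalizing y
      · have h₂ : ∀ a b : ZMod 2, a ≠ b → a + 1 = b := by decide
        obtain ⟨p, k, hk, h⟩ := this (y + Pi.single i 1)
          (by simpa [Finset.sum_add_distrib] using h₂ _ _ hy)
        refine ⟨p, k, hk, h.trans ?_⟩
        rw [add_single_add_single]
        exact Sym2.eq_swap
      refine ⟨((iterComp g (min i.val L)).symm x, ⟨y - initialOnes n i, ?_⟩), flipTime L i, ?_, ?_⟩
      · simp [Finset.sum_sub_distrib, hy, sum_initialOnes i.2.le]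
      · unfold flipTime; omega
      · simp only [interleavedWalk_flipTime, Equiv.apply_symm_apply, sub_add_cancel]
    · refine ⟨((iterComp g j).symm x, ⟨y - initialOnes n (j + 1), ?_⟩), 2 * j + 1, by omega, ?_⟩
      · simp [Finset.sum_sub_distrib, hy, sum_initialOnes (show j + 1 ≤ n by omega)]
      · simp only [interleavedWalk_succ_odd hj, Equiv.apply_symm_apply, sub_add_cancel]
  · rintro ⟨x, y, hy⟩ ⟨x', y', hy'⟩ k hk l hl h
    have hfst := congrArg (Sym2.map Prod.fst) h
    have hsnd := congrArg (Sym2.map Prod.snd) h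
    rcases exists_eq_flipTime hL hk with ⟨i, hi, rfl⟩ | ⟨i, rfl⟩ <;>
      rcases exists_eq_flipTime hL hl with ⟨j, hj, rfl⟩ | ⟨j, rfl⟩
    · simp only [interleavedWalk_succ_odd, hi, hj, Sym2.map_mk] at hfst hsnd
      have h₁ : y + initialOnes n (i + 1) = y' + initialOnes n (j + 1) := by simpa using hsnd
      have h₂ : (i : ZMod 2) = j := by
        have : ∑ k, (y + initialOnes n (i + 1)) k =
            ∑ k, (y' + initialOnes n (j + 1)) k := by rw [h₁]
        rw [hsum y hy _ (by omega), hsum y' hy' _ (by omega)] at this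
        simpa using this
      obtain ⟨rfl, h₃⟩ := huniq i hi j hj h₂ _ _ hfst
      obtain rfl := (iterComp g i).injective h₃
      obtain rfl := add_right_cancel h₁
      exact ⟨rfl, rfl⟩
    · simp only [interleavedWalk_succ_odd, hi, interleavedWalk_flipTime, Sym2.map_mk,
        Sym2.eq_iff] at hfst
      rcases hfst with ⟨h₁, h₂⟩ | ⟨h₁, h₂⟩ <;> exact absurd (h₂.trans h₁.symm) (hg i hi _)
    · simp only [interleavedWalk_succ_odd, hj, interleavedWalk_flipTime, Sym2.map_mk,
        Sym2.eq_iff] at hfst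
      rcases hfst with ⟨h₁, h₂⟩ | ⟨h₁, h₂⟩
      · exact absurd (h₂.symm.trans h₁) (hg j hj _)
      · exact absurd (h₁.symm.trans h₂) (hg j hj _)
    · simp only [interleavedWalk_flipTime, Sym2.map_mk] at hfst hsnd
      have h₁ : iterComp g (min i.val L) x = iterComp g (min j.val L) x' := by simpa using hfst
      have hi := hsum y hy i i.2.le
      have hj := hsum y' hy' j j.2.le
      generalize hu : y + initialOnes n i = u at hi hsnd
      generalize hv : y' + initialOnes n j = v at hj hsnd
      rcases Sym2.eq_iff.1 hsnd with ⟨huv, h₂⟩ | ⟨h₂, h₃⟩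
      · rw [huv] at h₂
        obtain rfl : i = j := single_one_injective (add_left_cancel h₂)
        obtain rfl := (iterComp g _).injective h₁
        obtain rfl := add_right_cancel (hu.trans (huv.trans hv.symm))
        exact ⟨rfl, rfl⟩
      · exfalso
        have h₄ : i = j := by
          rw [h₂, add_assoc] at h₃
          have h₅ := add_eq_left.1 h₃
          have h₆ := add_single_add_single (Pi.single j 1) i
          rw [h₅, zero_add] at h₆
          exact single_one_injective h₆
        rw [h₂, h₄] at hi
        simp [Finset.sum_add_distrib, hj] at hi

end InterleavedWalk

/-! ### Partitioning hypercubes into paths -/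

namespace CycleFactorization

variable {V : Type} {A : SimpleGraph V} {h N m : ℕ}

theorem pathPartition {ι : Type} (F : CycleFactorization A ι N) (hm : 0 < m) (hmN : m ∣ N)
    (hlt : m < N) (hN : 2 < N) : PathPartition m A.edgeSet := by
  convert PathPartition.iUnion (fun i => PathPartition.of_perm hm hmN hlt hN (F.pos_next i)) ?_
  · ext e
    induction e with | h u v => ?_
    simp only [Set.mem_iUnion, Set.mem_range]
    refine ⟨F.exists_next u v, ?_⟩
    rintro ⟨i, x, hx⟩
    rw [← hx]
    exact F.adj_next i x
  · rintro i j _ ⟨x, rfl⟩ ⟨y, h⟩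
    exact (F.next_unique _ _ _ _ h).1.symm

/-- In `A □ hypercube n`, each cycle family of `A` is used on the odd and on the even layers
separately, as number `2 * i` and `2 * i + 1`. The first `L` of these `2 * h` half-families are
absorbed by walks of length `n + L = m`, and the others are cut into paths of length `m`. -/
theorem pathPartition_boxProd (F : CycleFactorization A (Fin h) N) {n L : ℕ} (hLn : L ≤ n)
    (hLh : L ≤ 2 * h) (hL : n + L = m) (hm : 0 < m) (hmN : m ∣ N)
    (hlt : m < N) (hN : 2 < N) : PathPartition m (A □ hypercube n).edgeSet := by
  let g : ℕ → Equiv.Perm V := fun j => if hj : j / 2 < h then F.next ⟨j / 2, hj⟩ else 1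
  have hg : ∀ j (hj : j / 2 < h), g j = F.next ⟨j / 2, hj⟩ := fun j hj => dif_pos hj
  have hadj : ∀ j < 2 * h, ∀ x, A.Adj x (g j x) := fun j hj x => by
    rw [hg j (by omega)]
    exact F.adj_next _ x
  have huniq : ∀ i < 2 * h, ∀ j < 2 * h, (i : ZMod 2) = j → ∀ x y, s(x, g i x) = s(y, g j y) →
      i = j ∧ x = y := by
    intro i hi j hj hij x y hxy
    rw [hg i (by omega), hg j (by omega)] at hxy
    obtain ⟨h₁, h₂⟩ := F.next_unique _ _ _ _ hxy
    have h₃ := (ZMod.natCast_eq_natCast_iff' i j 2).1 hij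
    have h₄ := Fin.mk.inj h₁
    exact ⟨by omega, h₂⟩
  have hwalk := pathPartition_interleavedWalk (n := n) hLn
    (fun j hj x => (hadj j (by omega) x).ne')
    fun i hi j hj => huniq i (by omega) j (by omega)
  rw [hL] at hwalk
  have hrest := PathPartition.iUnion
    (ι := {p : ℕ × (Fin n → ZMod 2) // L ≤ p.1 ∧ p.1 < 2 * h ∧ ∑ i, p.2 i = (p.1 : ZMod 2) + 1})
    (E := fun p => Sym2.map (fun x => (x, p.1.2)) '' Set.range fun x => s(x, g p.1.1 x))
    (m := m) ?_ ?_
  · convert hwalk.union hrest ?_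
    · ext e
      simp only [Set.mem_union, Set.mem_iUnion, Set.mem_ofPred_eq, Set.mem_image, Set.mem_range,
        exists_exists_eq_and, Sym2.map_mk, Subtype.exists, Prod.exists]
      constructor
      · induction e with | h p q => ?_
        obtain ⟨u, y⟩ := p
        obtain ⟨v, z⟩ := q
        rw [SimpleGraph.mem_edgeSet, SimpleGraph.boxProd_adj]
        rintro (⟨huv, rfl : y = z⟩ | ⟨hyz, rfl : u = v⟩)
        · obtain ⟨i, x, hx⟩ := F.exists_next u v huv
          -- the half-family of this edge is the one whose parity matches the layer
          obtain ⟨j, hj, hjy⟩ : ∃ j, j / 2 = i.val ∧ ∑ k, y k = (j : ZMod 2) + 1 := by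
            have h₂ : ∀ a : ZMod 2, a = 1 + 1 ∨ a = 0 + 1 := by decide
            have h₃ : ((2 * i.val : ℕ) : ZMod 2) = 0 :=
              (ZMod.natCast_eq_zero_iff _ _).2 (Nat.dvd_mul_right 2 _)
            rcases h₂ (∑ k, y k) with h | h
            · exact ⟨2 * i.val + 1, by omega, by rw [h, Nat.cast_succ, h₃, zero_add]⟩
            · exact ⟨2 * i.val, by omega, by rw [h, h₃]⟩
          have hji : g j = F.next i := by
            rw [hg j (by omega)]; congr 1; exact Fin.ext hj
          have hx' : s((x, y), (g j x, y)) = s((u, y), (v, y)) := by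
            rw [hji]
            exact congrArg (Sym2.map fun x => (x, y)) hx
          by_cases hjL : j < L
          · exact .inl (.inr ⟨j, hjL, x, y, hjy, hx'⟩)
          · exact .inr ⟨j, y, ⟨by omega, by omega, hjy⟩, x, hx'⟩
        · obtain ⟨i, rfl⟩ := hypercube_adj_iff.1 hyz
          exact .inl (.inl ⟨u, y, i, rfl⟩)
      · rintro ((⟨x, y, i, rfl⟩ | ⟨j, hj, x, y, -, rfl⟩) | ⟨j, y, hj, x, rfl⟩)
        · exact SimpleGraph.boxProd_adj.2 (.inr ⟨hypercube_adj_iff.2 ⟨i, rfl⟩, rfl⟩)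
        · exact SimpleGraph.boxProd_adj.2 (.inl ⟨hadj j (by omega) x, rfl⟩)
        · exact SimpleGraph.boxProd_adj.2 (.inl ⟨hadj j (by omega) x, rfl⟩)
    · intro e he he'
      simp only [Set.mem_iUnion, Set.mem_image, Set.mem_range,
        exists_exists_eq_and, Sym2.map_mk, Subtype.exists, Prod.exists] at he'
      obtain ⟨j, y, ⟨hLj, hj, hy⟩, x, rfl⟩ := he'
      have hne := (hadj j hj x).ne
      rcases he with ⟨x', y', i, h⟩ | ⟨j', hj', x', y', hy', h⟩
      · have := congrArg (Sym2.map Prod.fst) h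
        simp only [Sym2.map_mk, Sym2.eq_iff] at this
        grind
      · have h₁ := congrArg (Sym2.map Prod.fst) h
        have h₂ := congrArg (Sym2.map Prod.snd) h
        simp only [Sym2.map_mk] at h₁ h₂
        obtain rfl : y' = y := by simpa using h₂
        have := (huniq j' (by omega) j hj (add_right_cancel (hy'.symm.trans hy)) _ _ h₁).1
        omega
  · rintro ⟨⟨j, y⟩, hLj, hj, hy⟩
    refine PathPartition.image ?_ fun a b hab => (Prod.mk.inj hab).1
    simp only [hg j (by omega)]
    exact PathPartition.of_perm hm hmN hlt hN (F.pos_next _)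
  · rintro ⟨⟨j, y⟩, hLj, hj, hy⟩ ⟨⟨j', y'⟩, hLj', hj', hy'⟩ _ ⟨_, ⟨x, rfl⟩, rfl⟩
      ⟨_, ⟨x', rfl⟩, h⟩
    have h₁ := congrArg (Sym2.map Prod.fst) h
    have h₂ := congrArg (Sym2.map Prod.snd) h
    simp only [Sym2.map_mk] at h₁ h₂ hy hy'
    obtain rfl : y' = y := by simpa using h₂
    obtain rfl := (huniq j' (by omega) j hj (add_right_cancel (hy'.symm.trans hy)) _ _ h₁).1
    rfl

end CycleFactorization

theorem pathPartition_hypercube {t : ℕ} (ht : 16 ≤ t) (ht' : t ≤ 31) {q : ℕ} (hq : 2 ^ t ≤ q) :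
    PathPartition (2 ^ t) (hypercube q).edgeSet := by
  obtain ⟨F⟩ := exists_cycleFactorization_hypercube 4
  have h₁ : 2 ^ 16 ≤ 2 ^ t := Nat.pow_le_pow_right (by omega) ht
  have hdvd : 2 ^ t ∣ 2 ^ 2 ^ (4 + 1) := pow_dvd_pow 2 (by omega)
  have hlt : 2 ^ t < 2 ^ 2 ^ (4 + 1) := Nat.pow_lt_pow_right (by omega) (by omega)
  have h2 : 2 < 2 ^ 2 ^ (4 + 1) := by norm_num
  have hpos : 0 < 2 ^ t := by positivity
  have h32 : 2 ^ (4 + 1) = 32 := by norm_num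
  induction q using Nat.strong_induction_on with
  | _ q ih =>
    obtain ⟨n, rfl⟩ : ∃ n, q = 2 ^ (4 + 1) + n := ⟨q - 2 ^ (4 + 1), by omega⟩
    refine PathPartition.of_iso (hypercubeAddIso _ _).symm ?_
    by_cases hn : n ≤ 2 ^ t
    · -- the `n + 32 - 2 ^ t` remaining half-families are cut into paths
      exact F.pathPartition_boxProd (L := 2 ^ t - n) (by omega) (by omega) (by omega) hpos
        hdvd hlt h2
    · exact (F.pathPartition hpos hdvd hlt h2).boxProd (ih n (by omega) (by omega))

theorem corollary5 (t : ℕ) (ht : 16 ≤ t) (ht' : t ≤ 31) (q : ℕ) (hq : 2 ^ t ≤ q) :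
    GraphDivides (pathOfLength (2 ^ t)) (hypercube q) :=
  (pathPartition_hypercube ht ht' hq).graphDivides
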